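/- For a commutative ring $S$ and $p,r\in S$ with $p$ invertible, let $A_{p,r}(S)=S\langle x,y\rangle/(xy-p\,yx-r)$ be the quantized Weyl algebra, and let $\mathcal{O}(A_{p,r}(S))$ be the full subcategory of the category of left $A_{p,r}(S)$-modules consisting of the modules $M$ on which $x$ acts locally nilpotently (for every $m\in M$ there is $n\ge 0$ with $x^n m=0$). For $q\in S$ and $n\ge 1$ put $[n]_q=1+q+\dots+q^{n-1}$ (which is $\frac{1-q^n}{1-q}$ whenever $1-q$ is invertible). Corollary. Let $\mathbf{k}$ be a subfield of a commutative ring $S$, let $l\ge 1$, let $u\in\mathbf{k}$ be a primitive $l$-th root of unity, let $b\in S$ be nilpotent, and let $q=u+b$. Then the category $\mathcal{O}(A_{q,1}(S))$ is equivalent to the category $\mathcal{O}(A_{q^l,[l]_q}(S))$. -/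

import Mathlib

open CategoryTheory

universe u v w

/-- The `q`-integer `[n]_q = 1 + q + ⋯ + q^(n-1)`, i.e. `(1 - q^n) / (1 - q)` read as a polynomial
in `q` (so that it also makes sense when `1 - q` is not invertible). -/
def qInt {S : Type u} [CommRing S] (n : ℕ) (q : S) : S :=
  ∑ i ∈ Finset.range n, q ^ i

namespace QuantizedWeyl

/-- The defining relation `x y = p y x + r` on the free algebra `S⟨x, y⟩`, where the free
generators are `x = ι 0` and `y = ι 1`. -/
inductive Rel {S : Type u} [CommRing S] (p r : S) :
    FreeAlgebra S (Fin 2) → FreeAlgebra S (Fin 2) → Prop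
  | xy : Rel p r
      (FreeAlgebra.ι S 0 * FreeAlgebra.ι S 1)
      (p • (FreeAlgebra.ι S 1 * FreeAlgebra.ι S 0) + algebraMap S (FreeAlgebra S (Fin 2)) r)

end QuantizedWeyl

/-- The quantized Weyl algebra `A_{p,r}(S) = S⟨x, y⟩ / (x y - p y x - r)`. -/
abbrev QuantizedWeyl {S : Type u} [CommRing S] (p r : S) : Type u :=
  RingQuot (QuantizedWeyl.Rel p r)

namespace QuantizedWeyl

/-- The generator `x` of `A_{p,r}(S)`. -/
def x {S : Type u} [CommRing S] (p r : S) : QuantizedWeyl p r :=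
  RingQuot.mkAlgHom S (Rel p r) (FreeAlgebra.ι S 0)

/-- The generator `y` of `A_{p,r}(S)`. -/
def y {S : Type u} [CommRing S] (p r : S) : QuantizedWeyl p r :=
  RingQuot.mkAlgHom S (Rel p r) (FreeAlgebra.ι S 1)

/-- The property of a left `A_{p,r}(S)`-module that `x` acts on it locally nilpotently. -/
def xLocallyNilpotent {S : Type u} [CommRing S] (p r : S) :
    ObjectProperty (ModuleCat.{v} (QuantizedWeyl p r)) :=
  fun M => ∀ m : M, ∃ n : ℕ, (x p r) ^ n • m = 0

/-- The category `𝒪(A_{p,r}(S))`: the full subcategory of the category of left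
`A_{p,r}(S)`-modules whose objects are the modules on which `x` acts locally nilpotently. -/
abbrev CategoryO {S : Type u} [CommRing S] (p r : S) :=
  (xLocallyNilpotent.{u, v} p r).FullSubcategory

end QuantizedWeyl

/-! Write l = n + 1 and z = 1 + (q - 1)yx, so that xz = qzx and zy = qyz. Let M be in 𝒪. Then z
fixes ker x, and x z^l = q^l z^l x with q^l - 1 nilpotent, so z^l is locally unipotent on M. The
units l and 1 - q^i (0 < i < l) then split off the vectors on which z itself is unipotent. This part
is realised as the quotient N = M/W, where W consists of the vectors killed by some p(z) with p(1) a
unit.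

On N the operators X = x^l and "Y = y x^(-n)" satisfy XY = q^l YX + [l]_q (`quotX_mul_quotY`). The
map m ↦ (x^i m)_i is an isomorphism M ≅ N^l (`toCoind_bijective`): x^i y^j sends unipotent vectors
into W when i ≠ j, while x^j y^j is onto the unipotent part. Conversely, `coindX_mul_coindY` makes
N^l a module over A_{q,1}(S) for every such pair X, Y. This functor is full because a morphism
commutes with z, hence preserves W = {v 0 = 0}, and so comes from a map on coordinate 0
(`exists_apply_eq_of_commute_coind`). For l = 1 the two categories coincide. -/

open Polynomial

/-! ### Unipotent and non-unipotent vectors of an operator over a commutative ring. -/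

section UnipotentPart

variable {S : Type*} [CommRing S] {M : Type*} [AddCommGroup M] [Module S M]
  {M' : Type*} [AddCommGroup M'] [Module S M']

/-- Modulo X - 1 the polynomial p is the unit p(1). This Bézout identity replaces spectral
decomposition over a field. -/
theorem isCoprime_X_sub_one_pow {p : S[X]} (hp : IsUnit (p.eval 1)) (k : ℕ) :
    IsCoprime p ((X - C 1) ^ k) := by
  refine IsCoprime.pow_right ?_
  obtain ⟨c, hc⟩ := X_sub_C_dvd_sub_C_eval (a := 1) (p := p)
  obtain ⟨d, hd⟩ := hp.exists_left_inv
  refine ⟨C d, -(C d * c), ?_⟩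
  have : C d * C (p.eval 1) = 1 := by rw [← C_mul, hd, C_1]
  linear_combination (C d) * hc + this

/-- The vectors killed by some `p(z)` with `p(1)` invertible. -/
def nonunipotentPart (z : Module.End S M) : Submodule S M where
  carrier := {m | ∃ p : S[X], IsUnit (p.eval 1) ∧ aeval z p m = 0}
  zero_mem' := ⟨1, by simp, by simp⟩
  add_mem' := by
    rintro a b ⟨p, hp, hpa⟩ ⟨r, hr, hrb⟩
    refine ⟨p * r, by simpa using hp.mul hr, ?_⟩
    rw [map_add]
    nth_rewrite 1 [mul_comm p r]
    simp [hpa, hrb]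
  smul_mem' := by
    rintro c a ⟨p, hp, hpa⟩
    exact ⟨p, hp, by simp [hpa]⟩

theorem mem_maxGenEigenspace_iff_aeval {z : Module.End S M} {c : S} {m : M} :
    m ∈ z.maxGenEigenspace c ↔ ∃ k : ℕ, aeval z ((X - C c) ^ k) m = 0 := by
  simp [Module.End.mem_maxGenEigenspace, Algebra.algebraMap_eq_smul_one]

theorem aeval_apply_mem_maxGenEigenspace (z : Module.End S M) (p : S[X]) {c : S} {m : M}
    (hm : m ∈ z.maxGenEigenspace c) : aeval z p m ∈ z.maxGenEigenspace c := by
  rw [mem_maxGenEigenspace_iff_aeval] at hm ⊢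
  obtain ⟨k, hk⟩ := hm
  refine ⟨k, ?_⟩
  rw [← Module.End.mul_apply, ← map_mul, mul_comm, map_mul, Module.End.mul_apply, hk, map_zero]

theorem eq_zero_of_aeval_apply_eq_zero {z : Module.End S M} {m : M} {p : S[X]}
    (hp : IsUnit (p.eval 1)) (hm : m ∈ z.maxGenEigenspace 1) (h : aeval z p m = 0) : m = 0 := by
  rw [mem_maxGenEigenspace_iff_aeval] at hm
  obtain ⟨k, hk⟩ := hm
  obtain ⟨a, b, hab⟩ := isCoprime_X_sub_one_pow hp k
  rw [C_1] at hk hab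
  have := congrArg (fun r => aeval z r m) hab
  simpa only [map_add, map_mul, LinearMap.add_apply, Module.End.mul_apply, h, hk, map_zero,
    add_zero, map_one, Module.End.one_apply, eq_comm, C_1] using this

theorem eq_zero_of_mem_nonunipotentPart {z : Module.End S M} {m : M}
    (hm : m ∈ z.maxGenEigenspace 1) (h : m ∈ nonunipotentPart z) : m = 0 := by
  obtain ⟨p, hp, hpm⟩ := h
  exact eq_zero_of_aeval_apply_eq_zero hp hm hpm

theorem exists_aeval_apply_eq {z : Module.End S M} {m : M} {p : S[X]}
    (hp : IsUnit (p.eval 1)) (hm : m ∈ z.maxGenEigenspace 1) :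
    ∃ m' ∈ z.maxGenEigenspace 1, aeval z p m' = m := by
  obtain ⟨k, hk⟩ := mem_maxGenEigenspace_iff_aeval.1 hm
  obtain ⟨a, b, hab⟩ := isCoprime_X_sub_one_pow hp k
  refine ⟨aeval z a m, aeval_apply_mem_maxGenEigenspace z a hm, ?_⟩
  rw [C_1, mul_comm a p] at hab
  rw [C_1] at hk
  have := congrArg (fun r => aeval z r m) hab
  simpa only [map_add, map_mul, LinearMap.add_apply, Module.End.mul_apply, hk, map_zero,
    add_zero, map_one, Module.End.one_apply] using this

theorem maxGenEigenspace_le_nonunipotentPart (z : Module.End S M) {c : S} (hc : IsUnit (1 - c)) :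
    z.maxGenEigenspace c ≤ nonunipotentPart z := by
  intro m hm
  obtain ⟨k, hk⟩ := mem_maxGenEigenspace_iff_aeval.1 hm
  exact ⟨_, by simpa using hc.pow k, hk⟩

/-- In (X^l - 1)^k = P (X - 1)^k the factor P takes the unit value l^k at 1, so the factors are
coprime and m splits accordingly. -/
theorem exists_sub_mem_nonunipotentPart {z : Module.End S M} {l : ℕ} (hl : IsUnit (l : S)) {m : M}
    (hm : m ∈ (z ^ l).maxGenEigenspace 1) :
    ∃ m' ∈ z.maxGenEigenspace 1, m - m' ∈ nonunipotentPart z := by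
  obtain ⟨k, hk⟩ := Module.End.mem_maxGenEigenspace _ _ _ |>.1 hm
  set P : S[X] := (∑ i ∈ Finset.range l, X ^ i) ^ k with hP
  have hP1 : IsUnit (P.eval 1) := by
    simpa [hP, eval_finsetSum] using hl.pow k
  have hfac : P * (X - C 1) ^ k = (X ^ l - 1) ^ k := by
    rw [hP, ← mul_pow, C_1, geom_sum_mul]
  have hkill : aeval z (P * (X - C 1) ^ k) m = 0 := by
    rw [hfac]; simpa using hk
  obtain ⟨a, b, hab⟩ := isCoprime_X_sub_one_pow hP1 k
  refine ⟨aeval z (a * P) m, ?_, P, hP1, ?_⟩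
  · refine mem_maxGenEigenspace_iff_aeval.2 ⟨k, ?_⟩
    rw [← Module.End.mul_apply, ← map_mul,
      show (X - C 1) ^ k * (a * P) = a * (P * (X - C 1) ^ k) by ring, map_mul,
      Module.End.mul_apply, hkill, map_zero]
  · have h1 : m - aeval z (a * P) m = aeval z (b * (X - C 1) ^ k) m := by
      have := congrArg (fun r => aeval z r m) hab
      rw [map_add, LinearMap.add_apply, map_one (aeval z), Module.End.one_apply] at this
      rw [sub_eq_iff_eq_add', this]
    rw [h1, ← Module.End.mul_apply, ← map_mul,
      show P * (b * (X - C 1) ^ k) = b * (P * (X - C 1) ^ k) by ring, map_mul,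
      Module.End.mul_apply, hkill, map_zero]

theorem map_aeval_apply_of_twisted_commute {z : Module.End S M} {z' : Module.End S M'} {c : S}
    {f : M →ₗ[S] M'} (h : ∀ m, f (z m) = c • z' (f m)) (p : S[X]) (m : M) :
    f (aeval z p m) = aeval z' (p.comp (C c * X)) (f m) := by
  induction p using Polynomial.induction_on' with
  | add p r hp hr => simp [hp, hr]
  | monomial k a =>
    have : ∀ m, f ((z ^ k) m) = c ^ k • (z' ^ k) (f m) := by
      induction k with
      | zero => simp
      | succ k ih => intro m; rw [pow_succ, Module.End.mul_apply, ih, h]; simp [pow_succ, smul_smul]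
    simp only [aeval_monomial, Module.End.mul_apply, Module.algebraMap_end_apply, map_smul, this,
      monomial_comp, map_mul, aeval_C, map_pow, mul_pow, aeval_X]
    rw [← map_pow, Module.algebraMap_end_apply]

theorem IsNilpotent.isUnit_of_sub {a b : S} (h : IsNilpotent (a - b)) (hb : IsUnit b) :
    IsUnit a := by
  have := h.isUnit_add_left_of_commute hb (Commute.all _ _)
  simpa using this

/-- The annihilator p becomes p(cX), whose value p(c) at 1 differs from p(1) by a nilpotent. -/
theorem map_mem_nonunipotentPart {z : Module.End S M} {z' : Module.End S M'} {c : S}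
    (hc : IsNilpotent (c - 1)) {f : M →ₗ[S] M'} (h : ∀ m, f (z m) = c • z' (f m)) {m : M}
    (hm : m ∈ nonunipotentPart z) : f m ∈ nonunipotentPart z' := by
  obtain ⟨p, hp, hpm⟩ := hm
  refine ⟨p.comp (C c * X), ?_, ?_⟩
  · have : IsNilpotent (p.eval c - p.eval 1) := by
      obtain ⟨d, hd⟩ := sub_dvd_eval_sub c 1 p
      rw [hd]
      exact (Commute.all _ _).isNilpotent_mul_right hc
    simpa using this.isUnit_of_sub hp
  · rw [← map_aeval_apply_of_twisted_commute h, hpm, map_zero]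

theorem map_mem_maxGenEigenspace_mul {z : Module.End S M} {z' : Module.End S M'} {c d : S}
    {f : M →ₗ[S] M'}
    (h : ∀ m, z' (f m) = c • f (z m)) {m : M} (hm : m ∈ z.maxGenEigenspace d) :
    f m ∈ z'.maxGenEigenspace (c * d) := by
  rw [Module.End.mem_maxGenEigenspace] at hm ⊢
  obtain ⟨k, hk⟩ := hm
  refine ⟨k, ?_⟩
  have : ∀ j, ((z' - (c * d) • (1 : Module.End S M')) ^ j) (f m)
      = c ^ j • f (((z - d • (1 : Module.End S M)) ^ j) m) := by
    intro j
    induction j with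
    | zero => simp
    | succ j ih =>
      rw [pow_succ', Module.End.mul_apply, ih, pow_succ' (z - _), Module.End.mul_apply]
      simp [h, smul_sub, smul_smul, pow_succ]
      ring_nf
  rw [this, hk, map_zero, smul_zero]

/-- Induction on n: f m is unipotent for w, hence for cw, so f (w - 1)^k m = (cw - 1)^k f m = 0 for
some k. Thus (w - 1)^k m lies in ker f, where w is the identity, and one more factor w - 1 kills it.
-/
theorem mem_maxGenEigenspace_one_of_pow_apply_eq_zero {f w : Module.End S M} {c : S}
    (hc : IsNilpotent (c - 1)) (h : ∀ m, f (w m) = c • w (f m)) (hw : ∀ m, f m = 0 → w m = m)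
    (n : ℕ) (m : M) (hm : (f ^ n) m = 0) : m ∈ w.maxGenEigenspace 1 := by
  induction n generalizing m with
  | zero => simp_all
  | succ n ih =>
    have h1 : f m ∈ w.maxGenEigenspace 1 := ih _ (by simpa [pow_succ] using hm)
    -- Since c - 1 is nilpotent, the zero operator has every vector in its generalized eigenspace
    -- for 1 - c; adding it moves the eigenvalue c of cw to 1.
    have h2 : f m ∈ (c • w + 0).maxGenEigenspace (c + (1 - c)) := by
      refine (Module.End.genEigenspace_inf_le_add (c • w) 0 c (1 - c) ⊤ ⊤
        (Commute.zero_right _)).trans (by simp) ⟨?_, ?_⟩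
      · obtain ⟨k, hk⟩ := (Module.End.mem_maxGenEigenspace _ _ _).1 h1
        refine (Module.End.mem_maxGenEigenspace _ _ _).2 ⟨k, ?_⟩
        have : c • w - c • (1 : Module.End S M) = c • (w - (1 : S) • (1 : Module.End S M)) := by
          rw [one_smul, smul_sub]
        rw [this, _root_.smul_pow, LinearMap.smul_apply, hk, smul_zero]
      · obtain ⟨k, hk⟩ := hc
        refine (Module.End.mem_maxGenEigenspace _ _ _).2 ⟨k, ?_⟩
        have : (0 : Module.End S M) - (1 - c) • (1 : Module.End S M) = (c - 1) • 1 := by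
          rw [zero_sub, ← neg_smul, neg_sub]
        rw [this, _root_.smul_pow, hk, zero_smul, LinearMap.zero_apply]
    obtain ⟨k, hk⟩ := (Module.End.mem_maxGenEigenspace _ _ _).1 h2
    rw [add_zero, add_sub_cancel] at hk
    have h3 : ∀ j, f (((w - (1 : S) • (1 : Module.End S M)) ^ j) m)
        = ((c • w - (1 : S) • (1 : Module.End S M)) ^ j) (f m) := by
      intro j
      induction j with
      | zero => simp
      | succ j ih =>
        rw [pow_succ', Module.End.mul_apply, pow_succ' (c • w - _), Module.End.mul_apply, ← ih]
        simp [h]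
    refine (Module.End.mem_maxGenEigenspace _ _ _).2 ⟨k + 1, ?_⟩
    rw [pow_succ', Module.End.mul_apply, LinearMap.sub_apply, hw _ (by rw [h3, hk])]
    simp

end UnipotentPart

/-! ### The operator z = 1 + cYX attached to a Weyl pair. -/

section WeylOperators

variable {S : Type*} [CommRing S] {N : Type*} [AddCommGroup N] [Module S N]

/-- For a pair of operators with `X Y = p Y X + r` and `1 + c r = p`, the operator `1 + c Y X`
commutes with `X` and `Y` up to the factor `p`. -/
def weylZ (c : S) (X Y : Module.End S N) : Module.End S N := 1 + c • (Y * X)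

theorem weylZ_apply (c : S) (X Y : Module.End S N) (m : N) :
    weylZ c X Y m = m + c • Y (X m) := rfl

section

variable {X Y : Module.End S N} {p r c : S} (h : X * Y = p • (Y * X) + r • 1) (hc : 1 + c * r = p)
include h

theorem weyl_apply (m : N) : X (Y m) = p • Y (X m) + r • m := by
  simpa using LinearMap.congr_fun h m

include hc

theorem apply_weylZ (m : N) : X (weylZ c X Y m) = p • weylZ c X Y (X m) := by
  simp only [weylZ_apply, map_add, map_smul, weyl_apply h]
  rw [← hc]
  module

theorem weylZ_apply_apply (m : N) : weylZ c X Y (Y m) = p • Y (weylZ c X Y m) := by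
  simp only [weylZ_apply, map_add, map_smul, weyl_apply h]
  rw [← hc]
  module

theorem mem_maxGenEigenspace_weylZ (hp : IsNilpotent (p - 1)) {m : N} (hX : ∃ k, (X ^ k) m = 0) :
    m ∈ (weylZ c X Y).maxGenEigenspace 1 := by
  obtain ⟨k, hk⟩ := hX
  refine mem_maxGenEigenspace_one_of_pow_apply_eq_zero hp (apply_weylZ h hc) ?_ k m hk
  intro m hm
  simp [weylZ_apply, hm]

theorem apply_weylZ_pow (l : ℕ) (m : N) :
    X ((weylZ c X Y ^ l) m) = p ^ l • (weylZ c X Y ^ l) (X m) := by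
  induction l with
  | zero => simp
  | succ l ih =>
    rw [pow_succ', Module.End.mul_apply, apply_weylZ h hc, ih, map_smul, smul_smul, pow_succ',
      Module.End.mul_apply]

theorem pow_apply_weylZ (l : ℕ) (m : N) :
    (X ^ l) (weylZ c X Y m) = p ^ l • weylZ c X Y ((X ^ l) m) := by
  induction l with
  | zero => simp
  | succ l ih =>
    rw [pow_succ', Module.End.mul_apply, ih, map_smul, apply_weylZ h hc, smul_smul, pow_succ,
      Module.End.mul_apply]

theorem mem_maxGenEigenspace_weylZ_pow {l : ℕ} (hp : IsNilpotent (p ^ l - 1)) {m : N}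
    (hX : ∃ k, (X ^ k) m = 0) : m ∈ (weylZ c X Y ^ l).maxGenEigenspace 1 := by
  obtain ⟨k, hk⟩ := hX
  refine mem_maxGenEigenspace_one_of_pow_apply_eq_zero hp (apply_weylZ_pow h hc l) ?_ k m hk
  intro m hm
  have h1 : weylZ c X Y m = m := by simp [weylZ_apply, hm]
  rw [Module.End.pow_apply]
  exact Function.iterate_fixed h1 l

end

theorem sub_one_mul_qInt (q : S) (n : ℕ) : (q - 1) * qInt n q = q ^ n - 1 := by
  rw [qInt, mul_geom_sum]

theorem qInt_succ (q : S) (n : ℕ) : qInt (n + 1) q = 1 + q * qInt n q := by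
  rw [qInt, geom_sum_succ, qInt, add_comm]

/-! ### The pair of operators on N^(n+1) built from a pair on N. -/

variable {n : ℕ}

/-- The action of `x` on `N^(n+1)` coinduced from the operator `X` on `N`. -/
def coindX (n : ℕ) (X : Module.End S N) : Module.End S (Fin (n + 1) → N) :=
  LinearMap.pi (Fin.snoc (α := fun _ => (Fin (n + 1) → N) →ₗ[S] N)
    (fun j : Fin n => LinearMap.proj j.succ) (X ∘ₗ LinearMap.proj 0))

/-- The action of `y` on `N^(n+1)` coinduced from the operators `X`, `Y` on `N`. -/
def coindY (n : ℕ) (q : S) (X Y : Module.End S N) : Module.End S (Fin (n + 1) → N) :=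
  LinearMap.pi (Fin.cons (α := fun _ => (Fin (n + 1) → N) →ₗ[S] N)
    (Y ∘ₗ LinearMap.proj (Fin.last n))
    (fun j : Fin n => (qInt (j + 1) q • 1 + q ^ (j + 1 : ℕ) • (Y * X) : Module.End S N) ∘ₗ
      LinearMap.proj j.castSucc))

@[simp]
theorem coindX_castSucc (X : Module.End S N) (v : Fin (n + 1) → N) (j : Fin n) :
    coindX n X v j.castSucc = v j.succ := by
  simp [coindX]

@[simp]
theorem coindX_last (X : Module.End S N) (v : Fin (n + 1) → N) :
    coindX n X v (Fin.last n) = X (v 0) := by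
  simp [coindX]

@[simp]
theorem coindY_zero (q : S) (X Y : Module.End S N) (v : Fin (n + 1) → N) :
    coindY n q X Y v 0 = Y (v (Fin.last n)) := by
  simp [coindY]

@[simp]
theorem coindY_succ (q : S) (X Y : Module.End S N) (v : Fin (n + 1) → N) (j : Fin n) :
    coindY n q X Y v j.succ =
      qInt (j + 1) q • v j.castSucc + q ^ (j + 1 : ℕ) • Y (X (v j.castSucc)) := by
  simp [coindY]

theorem coindY_coindX (q : S) (X Y : Module.End S N) (v : Fin (n + 1) → N) (i : Fin (n + 1)) :
    coindY n q X Y (coindX n X v) i = qInt i q • v i + q ^ (i : ℕ) • Y (X (v i)) := by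
  refine Fin.cases ?_ (fun j => ?_) i
  · simp [qInt]
  · simp

/-- Coordinate i models x^i m and YX models yx, so the formula for y is x^i y = q^i y x^i + [i]_q
x^(i-1). The relation between X and Y enters only at the last coordinate, where the shift wraps
around. -/
theorem coindX_mul_coindY {q : S} {X Y : Module.End S N}
    (h : X * Y = q ^ (n + 1) • (Y * X) + qInt (n + 1) q • 1) :
    coindX n X * coindY n q X Y = q • (coindY n q X Y * coindX n X) + (1 : S) • 1 := by
  refine LinearMap.ext fun v => funext fun i => ?_
  simp only [LinearMap.add_apply, LinearMap.smul_apply, Module.End.mul_apply, Pi.add_apply,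
    Pi.smul_apply, coindY_coindX, Module.End.one_apply]
  refine Fin.lastCases ?_ (fun j => ?_) i
  · simp only [coindX_last, coindY_zero, weyl_apply h, Fin.val_last, qInt_succ, pow_succ]
    module
  · simp only [coindX_castSucc, coindY_succ, Fin.val_castSucc, qInt_succ, pow_succ]
    module

theorem coindX_pow_apply_zero (X : Module.End S N) (v : Fin (n + 1) → N) (i : Fin (n + 1)) :
    ((coindX n X ^ (i : ℕ)) v) 0 = v i := by
  induction i using Fin.induction generalizing v with
  | zero => simp
  | succ j ih =>
    rw [Fin.val_succ, pow_succ, Module.End.mul_apply]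
    simpa using ih (coindX n X v)

theorem coindX_pow_succ_apply (X : Module.End S N) (v : Fin (n + 1) → N) (i : Fin (n + 1)) :
    ((coindX n X ^ (n + 1)) v) i = X (v i) := by
  have h0 : ∀ w : Fin (n + 1) → N, ((coindX n X ^ (n + 1)) w) 0 = X (w 0) := by
    intro w
    rw [pow_succ, Module.End.mul_apply]
    simpa using coindX_pow_apply_zero X (coindX n X w) (Fin.last n)
  rw [← coindX_pow_apply_zero X ((coindX n X ^ (n + 1)) v) i, ← Module.End.mul_apply, ← pow_add,
    add_comm (i : ℕ), pow_add, Module.End.mul_apply, h0, coindX_pow_apply_zero]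

theorem exists_coindX_pow_apply_eq_zero {X : Module.End S N} (hX : ∀ m, ∃ k, (X ^ k) m = 0)
    (v : Fin (n + 1) → N) : ∃ k, (coindX n X ^ k) v = 0 := by
  choose k hk using hX
  refine ⟨(n + 1) * ∑ i, k (v i), ?_⟩
  have : ∀ j, (coindX n X ^ ((n + 1) * j)) v = fun i => (X ^ j) (v i) := by
    intro j
    induction j with
    | zero => simp
    | succ j ih =>
      rw [mul_add, mul_one, add_comm ((n + 1) * j), pow_add, Module.End.mul_apply, ih]
      funext i
      rw [coindX_pow_succ_apply, pow_succ', Module.End.mul_apply]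
  rw [this]
  funext i
  exact Module.End.pow_map_zero_of_le
    (Finset.single_le_sum (f := fun i => k (v i)) (fun _ _ => Nat.zero_le _) (Finset.mem_univ i))
    (hk (v i))

theorem weylZ_coind_apply (q : S) (X Y : Module.End S N) (v : Fin (n + 1) → N)
    (i : Fin (n + 1)) :
    weylZ (q - 1) (coindX n X) (coindY n q X Y) v i = q ^ (i : ℕ) • weylZ (q - 1) X Y (v i) := by
  have := sub_one_mul_qInt q i
  simp only [weylZ_apply, Pi.add_apply, Pi.smul_apply, coindY_coindX]
  rw [smul_add, smul_smul, this]
  module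

/-- On coordinate i the operator z is q^i times a unipotent one, and 1 - q^i is a unit for i > 0.
Vanishing of coordinate 0 is thus detected by z alone. -/
theorem mem_nonunipotentPart_coind {q : S} {X Y : Module.End S N}
    (hq : ∀ i : ℕ, 0 < i → i ≤ n → IsUnit (1 - q ^ i))
    (hZ : ∀ m, m ∈ (weylZ (q - 1) X Y).maxGenEigenspace 1) (v : Fin (n + 1) → N) :
    v ∈ nonunipotentPart (weylZ (q - 1) (coindX n X) (coindY n q X Y)) ↔ v 0 = 0 := by
  constructor
  · intro hv
    refine eq_zero_of_mem_nonunipotentPart (hZ _) ?_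
    refine map_mem_nonunipotentPart (c := (1 : S)) (f := LinearMap.proj 0) (by simp) ?_ hv
    intro m
    simp [weylZ_coind_apply]
  · intro hv
    rw [← Finset.univ_sum_single v]
    refine Submodule.sum_mem _ fun i _ => ?_
    refine Fin.cases ?_ (fun j => ?_) i
    · simp [hv]
    · refine maxGenEigenspace_le_nonunipotentPart _ (c := q ^ (j + 1 : ℕ) * 1)
        (by simpa using hq (j + 1) (by omega) (by omega)) ?_
      refine map_mem_maxGenEigenspace_mul (f := LinearMap.single S (fun _ => N) j.succ) ?_ (hZ _)
      intro m
      funext i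
      rw [weylZ_coind_apply]
      by_cases hi : i = j.succ
      · subst hi; simp
      · simp [hi]

/-- F commutes with z, so coordinate 0 of F v depends only on v 0; the shift x carries this to the
other coordinates. -/
theorem exists_apply_eq_of_commute_coind {N' : Type*} [AddCommGroup N'] [Module S N'] {q : S}
    {X Y : Module.End S N} {X' Y' : Module.End S N'}
    (hq : ∀ i : ℕ, 0 < i → i ≤ n → IsUnit (1 - q ^ i))
    (hZ : ∀ m, m ∈ (weylZ (q - 1) X Y).maxGenEigenspace 1)
    (hZ' : ∀ m, m ∈ (weylZ (q - 1) X' Y').maxGenEigenspace 1)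
    (F : (Fin (n + 1) → N) →ₗ[S] (Fin (n + 1) → N'))
    (hFX : ∀ v, F (coindX n X v) = coindX n X' (F v))
    (hFY : ∀ v, F (coindY n q X Y v) = coindY n q X' Y' (F v)) :
    ∃ g : N →ₗ[S] N', (∀ v i, F v i = g (v i)) ∧ (∀ m, g (X m) = X' (g m)) ∧
      ∀ m, g (Y m) = Y' (g m) := by
  have hF0 : ∀ v, v 0 = 0 → F v 0 = 0 := by
    intro v hv
    rw [← mem_nonunipotentPart_coind hq hZ] at hv
    rw [← mem_nonunipotentPart_coind hq hZ']
    refine map_mem_nonunipotentPart (c := (1 : S)) (by simp) (fun m => ?_) hv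
    simp [weylZ_apply, hFX, hFY]
  set g : N →ₗ[S] N' := LinearMap.proj 0 ∘ₗ F ∘ₗ LinearMap.single S (fun _ => N) 0 with hg
  have hFg : ∀ v i, F v i = g (v i) := by
    intro v i
    induction i using Fin.induction generalizing v with
    | zero =>
      have := hF0 (v - Pi.single 0 (v 0)) (by simp)
      rw [map_sub, Pi.sub_apply, sub_eq_zero] at this
      exact this
    | succ j ih => rw [← coindX_castSucc X' (F v), ← hFX, ih, coindX_castSucc]
  refine ⟨g, hFg, fun m => ?_, fun m => ?_⟩
  · have := congrFun (hFX (fun _ => m)) (Fin.last n)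
    rwa [hFg, coindX_last, coindX_last, hFg] at this
  · have := congrFun (hFY (fun _ => m)) 0
    rwa [hFg, coindY_zero, coindY_zero, hFg] at this

end WeylOperators

/-! ### Recovering a module from its unipotent quotient. -/

section UnipotentQuotient

variable {S : Type*} [CommRing S] {M : Type*} [AddCommGroup M] [Module S M]

theorem weyl_pow_apply {X Y : Module.End S M} {q : S} (h : X * Y = q • (Y * X) + (1 : S) • 1)
    (j : ℕ) (m : M) : (X ^ (j + 1)) (Y m) =
      q ^ (j + 1) • Y ((X ^ (j + 1)) m) + qInt (j + 1) q • (X ^ j) m := by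
  induction j with
  | zero => simpa [qInt] using weyl_apply h m
  | succ j ih =>
    rw [pow_succ', Module.End.mul_apply, ih, map_add, map_smul, map_smul, weyl_apply h,
      ← Module.End.mul_apply X, ← Module.End.mul_apply X, ← pow_succ', ← pow_succ',
      show qInt (j + 1 + 1) q = qInt (j + 1) q + q ^ (j + 1) from Finset.sum_range_succ _ _,
      pow_succ q (j + 1)]
    module

/-- Operators `x`, `y` with `x y = q y x + 1` and `x` locally nilpotent, where `q` behaves like a
nilpotent perturbation of a primitive root of unity of order `n + 1 > 1`. -/
structure IsRootWeylPair (n : ℕ) (q : S) (x y : Module.End S M) : Prop where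
  rel : x * y = q • (y * x) + (1 : S) • 1
  locallyNilpotent : ∀ m, ∃ k, (x ^ k) m = 0
  isUnit : IsUnit q
  isUnit_one_sub : ∀ i : ℕ, 0 < i → i ≤ n → IsUnit (1 - q ^ i)
  isNilpotent : IsNilpotent (q ^ (n + 1) - 1)
  isUnit_natCast : IsUnit ((n + 1 : ℕ) : S)
  pos : 0 < n

namespace IsRootWeylPair

variable {n : ℕ} {q : S} {x y : Module.End S M} (h : IsRootWeylPair n q x y)

theorem one_add_sub (q : S) : 1 + (q - 1) * 1 = q := by ring

include h

/-- Each y multiplies the generalized eigenvalue of z by q and each x by its inverse, giving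
q^(j-i), which differs from 1 by a unit. -/
theorem pow_mul_pow_apply_mem {m : M} (hm : m ∈ (weylZ (q - 1) x y).maxGenEigenspace 1) {i j : ℕ}
    (hi : i ≤ n) (hj : j ≤ n) (hij : i ≠ j) :
    (x ^ i) ((y ^ j) m) ∈ nonunipotentPart (weylZ (q - 1) x y) := by
  obtain ⟨Q, rfl⟩ := h.isUnit
  have hy : ∀ j, (y ^ j) m ∈ (weylZ ((Q : S) - 1) x y).maxGenEigenspace ((Q : S) ^ j) := by
    intro j
    induction j with
    | zero => simpa using hm
    | succ j ih =>
      rw [pow_succ', pow_succ', Module.End.mul_apply]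
      exact map_mem_maxGenEigenspace_mul (weylZ_apply_apply h.rel (one_add_sub _)) ih
  have hx : ∀ i, (x ^ i) ((y ^ j) m) ∈
      (weylZ ((Q : S) - 1) x y).maxGenEigenspace (((Q⁻¹ : Sˣ) : S) ^ i * (Q : S) ^ j) := by
    intro i
    induction i with
    | zero => simpa using hy j
    | succ i ih =>
      rw [pow_succ', pow_succ', Module.End.mul_apply, mul_assoc]
      refine map_mem_maxGenEigenspace_mul (fun m => ?_) ih
      rw [apply_weylZ h.rel (one_add_sub _), smul_smul, Units.inv_mul, one_smul]
  refine maxGenEigenspace_le_nonunipotentPart _ ?_ (hx i)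
  rcases lt_or_gt_of_ne hij with hlt | hlt
  · obtain ⟨d, rfl⟩ := Nat.exists_eq_add_of_lt hlt
    rw [add_assoc, pow_add, ← mul_assoc, ← mul_pow, Units.inv_mul, one_pow, one_mul]
    exact h.isUnit_one_sub _ (by omega) (by omega)
  · obtain ⟨d, rfl⟩ := Nat.exists_eq_add_of_lt hlt
    have h1 := h.isUnit_one_sub (d + 1) (by omega) (by omega)
    have h2 : (1 : S) - ((Q⁻¹ : Sˣ) : S) ^ (j + d + 1) * (Q : S) ^ j
        = -(((Q⁻¹ : Sˣ) : S) ^ (d + 1) * (1 - (Q : S) ^ (d + 1))) := by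
      rw [mul_sub, ← mul_pow, Units.inv_mul, one_pow, add_assoc, pow_add, mul_right_comm,
        ← mul_pow, Units.inv_mul, one_pow]
      ring
    rw [h2]
    exact (((Q⁻¹).isUnit.pow _).mul h1).neg

/-- From (q - 1)xy = qz - 1 follows (q - 1)x y^(j+1) = y^j (q^(j+1) z - 1). The last factor is
invertible on unipotent vectors because q^(j+1) - 1 is a unit. -/
theorem exists_pow_mul_pow_apply_eq {j : ℕ} (hj : j ≤ n) {m : M}
    (hm : m ∈ (weylZ (q - 1) x y).maxGenEigenspace 1) :
    ∃ m' ∈ (weylZ (q - 1) x y).maxGenEigenspace 1, (x ^ j) ((y ^ j) m') = m := by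
  induction j with
  | zero => exact ⟨m, hm, by simp⟩
  | succ j ih =>
    obtain ⟨m₁, hm₁, e₁⟩ := ih (by omega)
    have hu : IsUnit ((C (q ^ (j + 1)) * X - 1 : S[X]).eval 1) := by
      simpa using (h.isUnit_one_sub (j + 1) (by omega) hj).neg
    obtain ⟨m₂, hm₂, e₂⟩ := exists_aeval_apply_eq hu (Submodule.smul_mem _ (q - 1) hm₁)
    refine ⟨m₂, hm₂, ?_⟩
    have hq1 : IsUnit (q - 1) := by
      simpa using (h.isUnit_one_sub 1 one_pos h.pos).neg
    have hz : ∀ i w, weylZ (q - 1) x y ((y ^ i) w) = q ^ i • (y ^ i) (weylZ (q - 1) x y w) := by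
      intro i w
      induction i with
      | zero => simp
      | succ i ih =>
        rw [pow_succ', Module.End.mul_apply, weylZ_apply_apply h.rel (one_add_sub _), ih, map_smul,
          smul_smul, pow_succ' q, Module.End.mul_apply]
    have hxy : (q - 1) • x (y ((y ^ j) m₂)) = (y ^ j) ((q - 1) • m₁) := by
      rw [← e₂]
      have h1 : (q - 1) • x (y ((y ^ j) m₂))
          = q • weylZ (q - 1) x y ((y ^ j) m₂) - (y ^ j) m₂ := by
        rw [weyl_apply h.rel, weylZ_apply]
        module
      rw [h1, hz, smul_smul, ← pow_succ', ← map_smul, ← map_sub, map_sub, map_sub,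
        map_one (aeval _), map_mul, aeval_C, aeval_X, LinearMap.sub_apply, Module.End.mul_apply,
        Module.algebraMap_end_apply, Module.End.one_apply, map_sub]
    refine hq1.smul_left_cancel.1 ?_
    rw [pow_succ, pow_succ', Module.End.mul_apply, Module.End.mul_apply, ← map_smul, hxy, map_smul,
      map_smul, e₁]

theorem pow_apply_mem {m : M} (hm : m ∈ nonunipotentPart (weylZ (q - 1) x y)) :
    (x ^ (n + 1)) m ∈ nonunipotentPart (weylZ (q - 1) x y) :=
  map_mem_nonunipotentPart h.isNilpotent (pow_apply_weylZ h.rel (one_add_sub _) _) hm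

omit h in
/-- The map `m ↦ (xⁱ m)ᵢ` to the powers of the unipotent quotient. -/
def toCoind (n : ℕ) (q : S) (x y : Module.End S M) :
    M →ₗ[S] Fin (n + 1) → M ⧸ nonunipotentPart (weylZ (q - 1) x y) :=
  LinearMap.pi fun i => (nonunipotentPart (weylZ (q - 1) x y)).mkQ ∘ₗ (x ^ (i : ℕ))

omit h in
theorem toCoind_apply (m : M) (i : Fin (n + 1)) :
    toCoind n q x y m i = Submodule.Quotient.mk ((x ^ (i : ℕ)) m) := rfl

/-- If all x^i m lie in W, the same holds for x m, since x^(n+1) preserves W. Induction on the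
nilpotency order reduces to x m = 0, where z m = m, and W contains no nonzero unipotent vector. -/
theorem toCoind_injective : Function.Injective (toCoind n q x y) := by
  have key : ∀ k m, (∀ i ≤ n, (x ^ i) m ∈ nonunipotentPart (weylZ (q - 1) x y)) →
      (x ^ k) m = 0 → m = 0 := by
    intro k
    induction k with
    | zero => intro m _ hm; simpa using hm
    | succ k ih =>
      intro m hW hm
      have hxm : x m = 0 := by
        refine ih (x m) (fun i hi => ?_) (by rwa [← Module.End.mul_apply, ← pow_succ])
        rw [← Module.End.mul_apply, ← pow_succ]
        rcases hi.lt_or_eq with hi | rfl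
        · exact hW _ hi
        · exact h.pow_apply_mem (by simpa using hW 0 (Nat.zero_le _))
      refine eq_zero_of_mem_nonunipotentPart (z := weylZ (q - 1) x y) ?_
        (by simpa using hW 0 (Nat.zero_le _))
      exact (Module.End.mem_maxGenEigenspace _ _ _).2 ⟨1, by simp [weylZ_apply, hxm]⟩
  refine (injective_iff_map_eq_zero _).2 fun m hm => ?_
  obtain ⟨k, hk⟩ := h.locallyNilpotent m
  refine key k m (fun i hi => ?_) hk
  have := congrFun hm ⟨i, by omega⟩
  rwa [toCoind_apply, Pi.zero_apply, Submodule.Quotient.mk_eq_zero] at this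

theorem exists_toCoind_pow_apply_eq_single (j : Fin (n + 1))
    (ν : M ⧸ nonunipotentPart (weylZ (q - 1) x y)) :
    ∃ m ∈ (weylZ (q - 1) x y).maxGenEigenspace 1,
      toCoind n q x y ((y ^ (j : ℕ)) m) = Pi.single j ν := by
  obtain ⟨m, rfl⟩ := Submodule.Quotient.mk_surjective _ ν
  obtain ⟨m₀, hm₀, e₀⟩ := exists_sub_mem_nonunipotentPart h.isUnit_natCast
    (mem_maxGenEigenspace_weylZ_pow h.rel (one_add_sub q) h.isNilpotent (h.locallyNilpotent m))
  obtain ⟨m₁, hm₁, e₁⟩ := h.exists_pow_mul_pow_apply_eq (Nat.lt_succ_iff.1 j.2) hm₀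
  refine ⟨m₁, hm₁, funext fun i => ?_⟩
  rw [toCoind_apply]
  by_cases hij : i = j
  · subst hij
    rw [Pi.single_eq_same, e₁]
    exact ((Submodule.Quotient.eq _).2 e₀).symm
  · rw [Pi.single_eq_of_ne hij, Submodule.Quotient.mk_eq_zero]
    exact h.pow_mul_pow_apply_mem hm₁ (by omega) (by omega) (fun e => hij (Fin.ext e))

theorem toCoind_bijective : Function.Bijective (toCoind n q x y) := by
  refine ⟨h.toCoind_injective, fun v => ?_⟩
  choose f _ hf using fun j => h.exists_toCoind_pow_apply_eq_single j (v j)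
  refine ⟨∑ j : Fin (n + 1), (y ^ (j : ℕ)) (f j), ?_⟩
  rw [map_sum, Finset.sum_congr rfl fun j _ => hf j, Finset.univ_sum_single]

/-- `toCoind` as an equivalence. -/
noncomputable def equivCoind :
    M ≃ₗ[S] Fin (n + 1) → M ⧸ nonunipotentPart (weylZ (q - 1) x y) :=
  LinearEquiv.ofBijective (toCoind n q x y) h.toCoind_bijective

theorem equivCoind_apply (m : M) (i : Fin (n + 1)) :
    h.equivCoind m i = Submodule.Quotient.mk ((x ^ (i : ℕ)) m) := rfl

/-- The operator on the unipotent quotient induced by `x ^ (n + 1)`. -/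
def quotX : Module.End S (M ⧸ nonunipotentPart (weylZ (q - 1) x y)) :=
  Submodule.mapQ _ _ (x ^ (n + 1)) fun _ hm => h.pow_apply_mem hm

theorem quotX_mk (m : M) :
    h.quotX (Submodule.Quotient.mk m) = Submodule.Quotient.mk ((x ^ (n + 1)) m) := rfl

/-- The operator on the unipotent quotient sending the class of `x ^ n m` to that of `y m`. -/
noncomputable def quotY : Module.End S (M ⧸ nonunipotentPart (weylZ (q - 1) x y)) :=
  Submodule.mkQ _ ∘ₗ y ∘ₗ h.equivCoind.symm.toLinearMap ∘ₗ 
    LinearMap.single S (fun _ => M ⧸ nonunipotentPart (weylZ (q - 1) x y)) (Fin.last n)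

/-- The preimage of a vector supported at j < n is y^j m₁ with m₁ unipotent, and y sends it to
y^(j+1) m₁ in W. So the class of y m depends only on the last coordinate, x^n m. -/
theorem quotY_mk (m : M) :
    h.quotY (Submodule.Quotient.mk ((x ^ n) m)) = Submodule.Quotient.mk (y m) := by
  set T : (Fin (n + 1) → M ⧸ nonunipotentPart (weylZ (q - 1) x y)) →ₗ[S]
    M ⧸ nonunipotentPart (weylZ (q - 1) x y) :=
    Submodule.mkQ _ ∘ₗ y ∘ₗ h.equivCoind.symm.toLinearMap with hT
  have hT0 : ∀ j ν, j ≠ Fin.last n → T (Pi.single j ν) = 0 := by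
    intro j ν hj
    obtain ⟨m₁, hm₁, e₁⟩ := h.exists_toCoind_pow_apply_eq_single j ν
    have e₂ : h.equivCoind.symm (Pi.single j ν) = (y ^ (j : ℕ)) m₁ := by
      rw [LinearEquiv.symm_apply_eq]; exact e₁.symm
    simp only [hT, LinearMap.comp_apply, LinearEquiv.coe_coe, e₂, Submodule.mkQ_apply,
      Submodule.Quotient.mk_eq_zero]
    have hj' : (j : ℕ) + 1 ≤ n := by
      have := Fin.val_ne_of_ne hj
      simp at this
      omega
    simpa [pow_succ'] using h.pow_mul_pow_apply_mem hm₁ (Nat.zero_le n) hj' (by omega)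
  have h1 : T (h.equivCoind m) = Submodule.Quotient.mk (y m) := by
    simp [hT]
  have h2 : T (h.equivCoind m) = T (Pi.single (Fin.last n) (h.equivCoind m (Fin.last n))) := by
    conv_lhs => rw [← Finset.univ_sum_single (h.equivCoind m), map_sum]
    exact Finset.sum_eq_single _ (fun j _ hj => hT0 j _ hj) (by simp)
  rw [← h1, h2]
  rfl

theorem quotY_quotX_mk (m : M) :
    h.quotY (h.quotX (Submodule.Quotient.mk m)) = Submodule.Quotient.mk (y (x m)) := by
  rw [quotX_mk, pow_succ, Module.End.mul_apply, quotY_mk]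

/-- Every class is some x^n m modulo W. There XY gives x^(n+1) y m and YX gives y x^(n+1) m, so the
relation is the commutation rule for x^(n+1) and y. -/
theorem quotX_mul_quotY :
    h.quotX * h.quotY = q ^ (n + 1) • (h.quotY * h.quotX) + qInt (n + 1) q • 1 := by
  refine LinearMap.ext fun ν => ?_
  obtain ⟨m, hm⟩ := h.equivCoind.surjective (Pi.single (Fin.last n) ν)
  have hν : ν = Submodule.Quotient.mk ((x ^ n) m) := by
    have := congrFun hm (Fin.last n)
    rw [equivCoind_apply, Pi.single_eq_same] at this
    exact this.symm
  subst hν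
  simp only [Module.End.mul_apply, LinearMap.add_apply, LinearMap.smul_apply,
    Module.End.one_apply, quotY_mk, quotX_mk, weyl_pow_apply h.rel]
  rw [← Module.End.mul_apply (x ^ (n + 1)), ← pow_add, add_comm (n + 1) n,
    pow_add x n (n + 1), Module.End.mul_apply, quotY_mk]
  rfl

theorem exists_quotX_pow_apply_eq_zero (ν : M ⧸ nonunipotentPart (weylZ (q - 1) x y)) :
    ∃ k, (h.quotX ^ k) ν = 0 := by
  obtain ⟨m, rfl⟩ := Submodule.Quotient.mk_surjective _ ν
  obtain ⟨k, hk⟩ := h.locallyNilpotent m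
  have : ∀ j, (h.quotX ^ j) (Submodule.Quotient.mk m)
      = Submodule.Quotient.mk (((x ^ (n + 1)) ^ j) m) := by
    intro j
    induction j with
    | zero => rfl
    | succ j ih =>
      rw [pow_succ', Module.End.mul_apply, ih, quotX_mk, pow_succ' (x ^ (n + 1)),
        Module.End.mul_apply]
  refine ⟨k, ?_⟩
  rw [this, ← pow_mul, Module.End.pow_map_zero_of_le (Nat.le_mul_of_pos_left k n.succ_pos) hk]
  rfl

theorem equivCoind_x (m : M) : h.equivCoind (x m) = coindX n h.quotX (h.equivCoind m) := by
  funext i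
  refine Fin.lastCases ?_ (fun j => ?_) i
  · rw [coindX_last, equivCoind_apply, equivCoind_apply, Fin.val_zero, pow_zero,
      Module.End.one_apply, quotX_mk, pow_succ, Module.End.mul_apply, Fin.val_last]
  · rw [coindX_castSucc, equivCoind_apply, equivCoind_apply, Fin.val_succ, Fin.val_castSucc,
      pow_succ, Module.End.mul_apply]

theorem equivCoind_y (m : M) :
    h.equivCoind (y m) = coindY n q h.quotX h.quotY (h.equivCoind m) := by
  funext i
  refine Fin.cases ?_ (fun j => ?_) i
  · rw [coindY_zero, equivCoind_apply, equivCoind_apply, Fin.val_last, quotY_mk]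
    rfl
  · rw [coindY_succ, equivCoind_apply, equivCoind_apply, Fin.val_succ, Fin.val_castSucc,
      weyl_pow_apply h.rel, quotY_quotX_mk, ← Module.End.mul_apply x, ← pow_succ', add_comm]
    rfl

end IsRootWeylPair

end UnipotentQuotient

/-! ### Modules over A_{p,r}(S) as pairs of operators. -/

namespace QuantizedWeyl

variable {S : Type u} [CommRing S] {p r : S}

theorem x_mul_y (p r : S) :
    x p r * y p r = p • (y p r * x p r) + algebraMap S (QuantizedWeyl p r) r := by
  simpa [x, y] using RingQuot.mkAlgHom_rel S (Rel.xy (p := p) (r := r))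

theorem induction_on {motive : QuantizedWeyl p r → Prop}
    (algebraMap : ∀ s, motive (algebraMap S _ s)) (x : motive (x p r)) (y : motive (y p r))
    (mul : ∀ a b, motive a → motive b → motive (a * b))
    (add : ∀ a b, motive a → motive b → motive (a + b)) (a : QuantizedWeyl p r) : motive a := by
  obtain ⟨a, rfl⟩ := RingQuot.mkAlgHom_surjective S (Rel p r) a
  induction a using FreeAlgebra.induction with
  | grade0 s => rw [AlgHom.commutes]; exact algebraMap s
  | grade1 i =>
    fin_cases i
    · exact x
    · exact y
  | mul a b ha hb => rw [map_mul]; exact mul _ _ ha hb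
  | add a b ha hb => rw [map_add]; exact add _ _ ha hb

/-- An additive map between modules over `A_{p,r}(S)` commuting with the scalars, `x` and `y`
is linear. -/
def linearMapMk {M N : Type*} [AddCommGroup M] [AddCommGroup N] [Module (QuantizedWeyl p r) M]
    [Module (QuantizedWeyl p r) N] (f : M →+ N)
    (hs : ∀ (s : S) m, f (algebraMap S (QuantizedWeyl p r) s • m)
      = algebraMap S (QuantizedWeyl p r) s • f m)
    (hx : ∀ m, f (x p r • m) = x p r • f m) (hy : ∀ m, f (y p r • m) = y p r • f m) :
    M →ₗ[QuantizedWeyl p r] N where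
  toFun := f
  map_add' := map_add f
  map_smul' a m := by
    induction a using induction_on generalizing m with
    | algebraMap s => exact hs s m
    | x => exact hx m
    | y => exact hy m
    | mul a b ha hb => simp only [RingHom.id_apply] at ha hb ⊢; rw [mul_smul, ha, hb, mul_smul]
    | add a b ha hb =>
      simp only [RingHom.id_apply] at ha hb ⊢; rw [add_smul, map_add, ha, hb, add_smul]

section ofOperators

variable {N : Type v} [AddCommGroup N] [Module S N] (X Y : Module.End S N)
  (h : X * Y = p • (Y * X) + r • 1)

/-- The representation of `A_{p,r}(S)` given by two operators satisfying its relation. -/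
def lift : QuantizedWeyl p r →ₐ[S] Module.End S N :=
  RingQuot.liftAlgHom S ⟨FreeAlgebra.lift S ![X, Y], by
    rintro _ _ ⟨⟩
    simpa [Algebra.algebraMap_eq_smul_one] using h⟩

theorem lift_x : lift X Y h (x p r) = X := by
  simp [lift, x, RingQuot.liftAlgHom_mkAlgHom_apply]

theorem lift_y : lift X Y h (y p r) = Y := by
  simp [lift, y, RingQuot.liftAlgHom_mkAlgHom_apply]

/-- The left `A_{p,r}(S)`-module given by two operators satisfying its relation. -/
def ofOperators : ModuleCat.{v} (QuantizedWeyl p r) :=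
  letI : Module (QuantizedWeyl p r) N := Module.compHom N (lift X Y h).toRingHom
  ModuleCat.of _ N

/-- The identification of `ofOperators X Y h` with the module on which the operators act. -/
def ofOperatorsEquiv : ofOperators X Y h ≃+ N := AddEquiv.refl N

theorem ofOperatorsEquiv_smul (a : QuantizedWeyl p r) (m : ofOperators X Y h) :
    ofOperatorsEquiv X Y h (a • m) = lift X Y h a (ofOperatorsEquiv X Y h m) := rfl

theorem ofOperatorsEquiv_x_smul (m : ofOperators X Y h) :
    ofOperatorsEquiv X Y h (x p r • m) = X (ofOperatorsEquiv X Y h m) := by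
  rw [ofOperatorsEquiv_smul, lift_x]

theorem ofOperatorsEquiv_y_smul (m : ofOperators X Y h) :
    ofOperatorsEquiv X Y h (y p r • m) = Y (ofOperatorsEquiv X Y h m) := by
  rw [ofOperatorsEquiv_smul, lift_y]

theorem ofOperatorsEquiv_algebraMap_smul (s : S) (m : ofOperators X Y h) :
    ofOperatorsEquiv X Y h (algebraMap S (QuantizedWeyl p r) s • m)
      = s • ofOperatorsEquiv X Y h m := by
  rw [ofOperatorsEquiv_smul, AlgHom.commutes, Module.algebraMap_end_apply]

theorem xLocallyNilpotent_ofOperators (hX : ∀ m, ∃ k, (X ^ k) m = 0) :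
    xLocallyNilpotent p r (ofOperators X Y h) := by
  intro m
  obtain ⟨k, hk⟩ := hX (ofOperatorsEquiv X Y h m)
  refine ⟨k, (ofOperatorsEquiv X Y h).injective ?_⟩
  rw [ofOperatorsEquiv_smul, map_pow, lift_x, hk, map_zero]

end ofOperators

section toOperators

variable (M : ModuleCat.{v} (QuantizedWeyl p r))

/-- The `S`-module underlying an `A_{p,r}(S)`-module. -/
@[reducible]
def scalarModule : Module S M := Module.compHom M (algebraMap S (QuantizedWeyl p r))

attribute [local instance] scalarModule

theorem scalar_smul (s : S) (m : M) : s • m = algebraMap S (QuantizedWeyl p r) s • m := rfl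

/-- The action of `A_{p,r}(S)` on a module by `S`-linear operators. -/
def toEnd : QuantizedWeyl p r →ₐ[S] Module.End S M :=
  haveI : IsScalarTower S (QuantizedWeyl p r) M :=
    ⟨fun s a m => by rw [Algebra.smul_def, mul_smul]; rfl⟩
  Algebra.lsmul S S M

theorem toEnd_apply (a : QuantizedWeyl p r) (m : M) : toEnd M a m = a • m := rfl

theorem toEnd_x_mul_toEnd_y : toEnd M (x p r) * toEnd M (y p r)
    = p • (toEnd M (y p r) * toEnd M (x p r)) + r • 1 := by
  rw [← map_mul, x_mul_y, map_add, map_smul, map_mul, AlgHom.commutes,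
    Algebra.algebraMap_eq_smul_one]

theorem toEnd_x_locallyNilpotent (hM : xLocallyNilpotent p r M) (m : M) :
    ∃ k, (toEnd M (x p r) ^ k) m = 0 := by
  obtain ⟨k, hk⟩ := hM m
  exact ⟨k, by rw [← map_pow, toEnd_apply, hk]⟩

/-! ### The coinduction functor and its equivalence on 𝒪. -/

variable (n : ℕ) (q : S)

/-- The module coinduced from an `A_{q^(n+1), [n+1]_q}(S)`-module to `A_{q,1}(S)`. -/
def coindObj (M : ModuleCat.{v} (QuantizedWeyl (q ^ (n + 1)) (qInt (n + 1) q))) :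
    ModuleCat.{v} (QuantizedWeyl q 1) :=
  ofOperators (coindX n (toEnd M (x _ _))) (coindY n q (toEnd M (x _ _)) (toEnd M (y _ _)))
    (coindX_mul_coindY (toEnd_x_mul_toEnd_y M))

/-- The underlying additive group of a coinduced module. -/
def coindObjEquiv (M : ModuleCat.{v} (QuantizedWeyl (q ^ (n + 1)) (qInt (n + 1) q))) :
    coindObj n q M ≃+ (Fin (n + 1) → M) := ofOperatorsEquiv _ _ _

section

variable {n q} {M : ModuleCat.{v} (QuantizedWeyl (q ^ (n + 1)) (qInt (n + 1) q))}
  (v : coindObj n q M)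

theorem coindObjEquiv_x_smul : coindObjEquiv n q M (x q 1 • v) =
    coindX n (toEnd M (x _ _)) (coindObjEquiv n q M v) := ofOperatorsEquiv_x_smul _ _ _ _

theorem coindObjEquiv_y_smul : coindObjEquiv n q M (y q 1 • v) =
    coindY n q (toEnd M (x _ _)) (toEnd M (y _ _)) (coindObjEquiv n q M v) :=
  ofOperatorsEquiv_y_smul _ _ _ _

theorem coindObjEquiv_algebraMap_smul (s : S) :
    coindObjEquiv n q M (algebraMap S (QuantizedWeyl q 1) s • v) = s • coindObjEquiv n q M v :=
  ofOperatorsEquiv_algebraMap_smul _ _ _ _ _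

end

section

variable {n q} {M M' : ModuleCat.{v} (QuantizedWeyl (q ^ (n + 1)) (qInt (n + 1) q))} (f : M ⟶ M')

/-- The additive map underlying `coindMap`. -/
def coindMapAux : coindObj n q M →+ coindObj n q M' :=
  AddMonoidHom.mk'
    (fun v => (coindObjEquiv n q M').symm fun i => f.hom (coindObjEquiv n q M v i))
    (fun v w => by rw [← map_add]; congr 1; funext i; simp)

theorem coindObjEquiv_coindMapAux (v : coindObj n q M) (i : Fin (n + 1)) :
    coindObjEquiv n q M' (coindMapAux f v) i = f.hom (coindObjEquiv n q M v i) := rfl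

/-- The map of coinduced modules defined by a map of modules. -/
def coindMap : coindObj n q M →ₗ[QuantizedWeyl q 1] coindObj n q M' :=
  linearMapMk (coindMapAux f)
    (fun s v => by
      refine (coindObjEquiv n q M').injective (funext fun i => ?_)
      simp only [coindObjEquiv_algebraMap_smul, coindObjEquiv_coindMapAux, Pi.smul_apply,
        scalar_smul, map_smul])
    (fun v => by
      refine (coindObjEquiv n q M').injective (funext fun i => ?_)
      refine Fin.lastCases ?_ (fun j => ?_) i <;>
        simp only [coindObjEquiv_x_smul, coindObjEquiv_coindMapAux, coindX_last, coindX_castSucc,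
          toEnd_apply, map_smul])
    (fun v => by
      refine (coindObjEquiv n q M').injective (funext fun i => ?_)
      refine Fin.cases ?_ (fun j => ?_) i <;>
        simp only [coindObjEquiv_y_smul, coindObjEquiv_coindMapAux, coindY_zero, coindY_succ,
          toEnd_apply, scalar_smul, map_smul, map_add])

theorem coindObjEquiv_coindMap (v : coindObj n q M) (i : Fin (n + 1)) :
    coindObjEquiv n q M' (coindMap f v) i = f.hom (coindObjEquiv n q M v i) := rfl

end

/-- Coinduction of modules from `A_{q^(n+1), [n+1]_q}(S)` to `A_{q,1}(S)`. -/
def coind : ModuleCat.{v} (QuantizedWeyl (q ^ (n + 1)) (qInt (n + 1) q)) ⥤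
    ModuleCat.{v} (QuantizedWeyl q 1) where
  obj := coindObj n q
  map {M M'} f := ModuleCat.ofHom (X := coindObj n q M) (Y := coindObj n q M') (coindMap f)
  map_id _ := rfl
  map_comp _ _ := rfl

variable {n q}

instance coind_faithful : (coind.{u, v} n q).Faithful where
  map_injective {M M'} f g hfg := by
    have hfg' : coindMap f = coindMap g := congrArg ModuleCat.Hom.hom hfg
    ext m
    have := coindObjEquiv_coindMap f ((coindObjEquiv n q M).symm fun _ => m) 0
    rw [hfg', coindObjEquiv_coindMap, AddEquiv.apply_symm_apply] at this
    exact this.symm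

theorem exists_coind_map_eq (hu : ∀ i : ℕ, 0 < i → i ≤ n → IsUnit (1 - q ^ i))
    (hn : IsNilpotent (q ^ (n + 1) - 1))
    {M M' : ModuleCat.{v} (QuantizedWeyl (q ^ (n + 1)) (qInt (n + 1) q))}
    (hM : xLocallyNilpotent _ _ M) (hM' : xLocallyNilpotent _ _ M')
    (f : (coind n q).obj M ⟶ (coind n q).obj M') : ∃ g : M ⟶ M', (coind n q).map g = f := by
  have hc : 1 + (q - 1) * qInt (n + 1) q = q ^ (n + 1) := by rw [sub_one_mul_qInt]; ring
  let e := coindObjEquiv n q M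
  let e' := coindObjEquiv n q M'
  let f' : coindObj n q M →ₗ[QuantizedWeyl q 1] coindObj n q M' := f.hom
  let F : (Fin (n + 1) → M) →ₗ[S] (Fin (n + 1) → M') :=
    { toFun := fun v => e' (f' (e.symm v))
      map_add' := fun v w => by simp
      map_smul' := fun s v => by
        rw [RingHom.id_apply, ← coindObjEquiv_algebraMap_smul, ← map_smul f']
        congr 2
        rw [AddEquiv.symm_apply_eq, coindObjEquiv_algebraMap_smul, AddEquiv.apply_symm_apply] }
  obtain ⟨g, hg, hgX, hgY⟩ := exists_apply_eq_of_commute_coind hu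
    (fun m => mem_maxGenEigenspace_weylZ (toEnd_x_mul_toEnd_y M) hc hn
      (toEnd_x_locallyNilpotent M hM m))
    (fun m => mem_maxGenEigenspace_weylZ (toEnd_x_mul_toEnd_y M') hc hn
      (toEnd_x_locallyNilpotent M' hM' m)) F
    (fun v => by
      change e' (f' (e.symm _)) = coindX n _ (e' (f' (e.symm v)))
      rw [← coindObjEquiv_x_smul, ← map_smul f']
      congr 2
      rw [AddEquiv.symm_apply_eq, coindObjEquiv_x_smul, AddEquiv.apply_symm_apply])
    (fun v => by
      change e' (f' (e.symm _)) = coindY n q _ _ (e' (f' (e.symm v)))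
      rw [← coindObjEquiv_y_smul, ← map_smul f']
      congr 2
      rw [AddEquiv.symm_apply_eq, coindObjEquiv_y_smul, AddEquiv.apply_symm_apply])
  refine ⟨ModuleCat.ofHom (linearMapMk g.toAddMonoidHom (fun s m => map_smul g s m) hgX hgY), ?_⟩
  refine ModuleCat.hom_ext (LinearMap.ext fun v => e'.injective (funext fun i => ?_))
  exact (hg (e v) i).symm

theorem xLocallyNilpotent_coind {M : ModuleCat.{v} (QuantizedWeyl (q ^ (n + 1)) (qInt (n + 1) q))}
    (hM : xLocallyNilpotent _ _ M) : xLocallyNilpotent _ _ ((coind n q).obj M) :=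
  xLocallyNilpotent_ofOperators _ _ _
    (exists_coindX_pow_apply_eq_zero (toEnd_x_locallyNilpotent M hM))

theorem exists_iso_coind {M : ModuleCat.{v} (QuantizedWeyl q 1)}
    (h : IsRootWeylPair n q (toEnd M (x q 1)) (toEnd M (y q 1))) :
    ∃ N : ModuleCat.{v} (QuantizedWeyl (q ^ (n + 1)) (qInt (n + 1) q)),
      xLocallyNilpotent _ _ N ∧ Nonempty ((coind n q).obj N ≅ M) := by
  let N := ofOperators h.quotX h.quotY h.quotX_mul_quotY
  let e : N ≃+ _ := ofOperatorsEquiv h.quotX h.quotY h.quotX_mul_quotY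
  refine ⟨N, xLocallyNilpotent_ofOperators _ _ _ h.exists_quotX_pow_apply_eq_zero, ⟨?_⟩⟩
  let φ : M ≃+ coindObj n q N := h.equivCoind.toAddEquiv.trans
    ((AddEquiv.piCongrRight fun _ => e.symm).trans (coindObjEquiv n q N).symm)
  have hφ : ∀ m i, e (coindObjEquiv n q N (φ m) i) = h.equivCoind m i := by
    intro m i
    simp [φ]
  have hs : ∀ (s : S) (a : N), e (s • a) = s • e a := fun s a =>
    ofOperatorsEquiv_algebraMap_smul _ _ _ s a
  have hX : ∀ a : N, e (x _ _ • a) = h.quotX (e a) := fun a => ofOperatorsEquiv_x_smul _ _ _ a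
  have hY : ∀ a : N, e (y _ _ • a) = h.quotY (e a) := fun a => ofOperatorsEquiv_y_smul _ _ _ a
  have hx' : ∀ m, h.equivCoind (x q 1 • m) = _ := h.equivCoind_x
  have hy' : ∀ m, h.equivCoind (y q 1 • m) = _ := h.equivCoind_y
  let ψ : M →ₗ[QuantizedWeyl q 1] coindObj n q N := linearMapMk φ.toAddMonoidHom
    (fun s m => by
      refine (coindObjEquiv n q N).injective (funext fun i => e.injective ?_)
      rw [coindObjEquiv_algebraMap_smul, Pi.smul_apply, hs]
      change e (coindObjEquiv n q N (φ _) i) = s • e (coindObjEquiv n q N (φ _) i)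
      rw [hφ, hφ, ← scalar_smul, map_smul, Pi.smul_apply])
    (fun m => by
      refine (coindObjEquiv n q N).injective (funext fun i => e.injective ?_)
      rw [coindObjEquiv_x_smul]
      change e (coindObjEquiv n q N (φ _) i) = e (coindX n _ (coindObjEquiv n q N (φ _)) i)
      rw [hφ, hx']
      refine Fin.lastCases ?_ (fun j => ?_) i
      · rw [coindX_last, coindX_last, toEnd_apply, hX, hφ]
      · rw [coindX_castSucc, coindX_castSucc, hφ])
    (fun m => by
      refine (coindObjEquiv n q N).injective (funext fun i => e.injective ?_)
      rw [coindObjEquiv_y_smul]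
      change e (coindObjEquiv n q N (φ _) i) = e (coindY n q _ _ (coindObjEquiv n q N (φ _)) i)
      rw [hφ, hy']
      refine Fin.cases ?_ (fun j => ?_) i
      · rw [coindY_zero, coindY_zero, toEnd_apply, hY, hφ]
      · rw [coindY_succ, coindY_succ, toEnd_apply, toEnd_apply, map_add, hs, hs, hY, hX, hφ])
  exact (LinearEquiv.ofBijective ψ φ.bijective).toModuleIso.symm

/-- Coinduction on the categories `𝒪`. -/
def coindO (n : ℕ) (q : S) :
    CategoryO.{u, v} (q ^ (n + 1)) (qInt (n + 1) q) ⥤ CategoryO.{u, v} q 1 :=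
  ObjectProperty.lift _ (ObjectProperty.ι _ ⋙ coind n q) fun M => xLocallyNilpotent_coind M.property

theorem isEquivalence_coindO (hpos : 0 < n) (hq : IsUnit q)
    (hu : ∀ i : ℕ, 0 < i → i ≤ n → IsUnit (1 - q ^ i)) (hn : IsNilpotent (q ^ (n + 1) - 1))
    (hc : IsUnit ((n + 1 : ℕ) : S)) : (coindO.{u, v} n q).IsEquivalence where
  faithful := by
    unfold coindO
    infer_instance
  full := ⟨fun {M M'} f => by
    obtain ⟨g, hg⟩ := exists_coind_map_eq hu hn M.property M'.property f.hom
    exact ⟨ObjectProperty.homMk g, ObjectProperty.hom_ext _ hg⟩⟩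
  essSurj := ⟨fun M => by
    obtain ⟨N, hN, ⟨i⟩⟩ := exists_iso_coind (n := n) (M := M.obj)
      { rel := by simpa using toEnd_x_mul_toEnd_y M.obj
        locallyNilpotent := toEnd_x_locallyNilpotent M.obj M.property
        isUnit := hq
        isUnit_one_sub := hu
        isNilpotent := hn
        isUnit_natCast := hc
        pos := hpos }
    exact ⟨⟨N, hN⟩, ⟨ObjectProperty.isoMk _ i⟩⟩⟩

end toOperators

end QuantizedWeyl

theorem mainTheorem2 {k : Type w} [Field k] {S : Type u} [CommRing S] [Nontrivial S] [Algebra k S]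
    (l : ℕ) (hl : 0 < l) (ζ : k) (hζ : IsPrimitiveRoot ζ l)
    (b : S) (hb : IsNilpotent b) (q : S) (hq : q = algebraMap k S ζ + b) :
    Nonempty (QuantizedWeyl.CategoryO.{u, v} q 1 ≌
      QuantizedWeyl.CategoryO.{u, v} (q ^ l) (qInt l q)) := by
  obtain ⟨n, rfl⟩ := Nat.exists_eq_add_of_lt hl
  rw [zero_add] at hζ ⊢
  -- Units are insensitive to nilpotents, so the conditions on powers of q reduce to those on powers
  -- of ζ.
  have hpow : ∀ i, IsNilpotent (q ^ i - algebraMap k S (ζ ^ i)) := by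
    intro i
    obtain ⟨d, hd⟩ := sub_dvd_pow_sub_pow q (algebraMap k S ζ) i
    rw [map_pow, hd]
    exact (Commute.all _ _).isNilpotent_mul_right (by simpa [hq] using hb)
  rcases Nat.eq_zero_or_pos n with rfl | hn
  -- For l = 1 the element q - 1 is nilpotent, so the splitting argument is unavailable, but the
  -- parameters agree.
  · have h1 : q ^ (0 + 1) = q := by simp
    have h2 : qInt (0 + 1) q = 1 := by simp [qInt]
    rw [h1, h2]
    exact ⟨CategoryTheory.Equivalence.refl⟩
  · have := QuantizedWeyl.isEquivalence_coindO.{u, v} (n := n) (q := q) hn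
      (by
        refine IsNilpotent.isUnit_of_sub (by simpa using hpow 1) ?_
        exact (hζ.isUnit n.succ_ne_zero).map (algebraMap k S))
      (fun i hi hin => by
        refine IsNilpotent.isUnit_of_sub (b := algebraMap k S (1 - ζ ^ i)) ?_ ?_
        · have := (hpow i).neg
          rw [map_sub, map_one]
          convert this using 1
          ring
        · refine (IsUnit.mk0 _ ?_).map (algebraMap k S)
          exact sub_ne_zero.2 (hζ.pow_ne_one_of_pos_of_lt hi.ne' (by omega)).symm)
      (by simpa [hζ.pow_eq_one] using hpow (n + 1))
      (by
        -- A field with a primitive l-th root of unity has characteristic not dividing l.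
        have : NeZero (n + 1) := ⟨n.succ_ne_zero⟩
        have h0 : ((n + 1 : ℕ) : k) ≠ 0 := hζ.neZero'.out
        simpa using (IsUnit.mk0 _ h0).map (algebraMap k S))
    exact ⟨(QuantizedWeyl.coindO.{u, v} n q).asEquivalence.symm⟩
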